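/- Let $k$ be an algebraically closed field of characteristic $0$ and let $L=L_{\bar 0}\oplus L_{\bar 1}$ be a semisimple Lie superalgebra over $k$ (that is, $L$ has no nonzero solvable $\mathbb{Z}/2$-graded ideal). Let $\mathfrak g$ be either the current superalgebra $L[x]=L\otimes_k k[x]$ or the loop superalgebra $L(x)=L\otimes_k k[x,x^{-1}]$, with bracket $[e\otimes x^r,f\otimes x^s]=[e,f]\otimes x^{r+s}$ and parity $|e\otimes x^r|=|e|$. Let $U(\mathfrak g)$ be the universal enveloping superalgebra of $\mathfrak g$, and let $$Z(\mathfrak g)=\{z\in U(\mathfrak g)\mid [z,u]=0\ \text{for all } u\in U(\mathfrak g)\}$$ be its center, where $[\cdot,\cdot]$ is the bilinear supercommutator given on homogeneous elements by $[z,u]=zu-(-1)^{|z||u|}uz$. Then the canonical map $k\to U(\mathfrak g)$ is injective and its image is $Z(\mathfrak g)$; that is, $Z(\mathfrak g)=k$. -/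

import Mathlib

open scoped TensorProduct Polynomial LaurentPolynomial DirectSum

noncomputable section

/-- The sign `(-1)^{ij}` attached to two parities `i, j` in `ℤ/2ℤ`, as a scalar of `k`. -/
def koszulSign (k : Type*) [CommRing k] (i j : ZMod 2) : k := (-1) ^ (i.val * j.val)

theorem koszulSign_comm (k : Type*) [CommRing k] (i j : ZMod 2) :
    koszulSign k i j = koszulSign k j i := by
  simp only [koszulSign, mul_comm]

/-- A Lie superalgebra structure on the `k`-module `L`: a `ℤ/2ℤ`-grading `L = L₀ ⊕ L₁` and a
bilinear bracket that respects the grading, is super skew-symmetric, and satisfies the super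
Jacobi identity. -/
structure LieSuperalgebra (k L : Type*) [CommRing k] [AddCommGroup L] [Module k L] where
  /-- the homogeneous components -/
  part : ZMod 2 → Submodule k L
  isCompl : IsCompl (part 0) (part 1)
  /-- the Lie superbracket -/
  bracket : L →ₗ[k] L →ₗ[k] L
  bracket_mem : ∀ {i j : ZMod 2} {x y : L}, x ∈ part i → y ∈ part j →
    bracket x y ∈ part (i + j)
  bracket_skew : ∀ {i j : ZMod 2} {x y : L}, x ∈ part i → y ∈ part j →
    bracket x y = -(koszulSign k i j • bracket y x)
  jacobi : ∀ {i j : ZMod 2} {x y : L} (z : L), x ∈ part i → y ∈ part j →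
    bracket x (bracket y z) =
      bracket (bracket x y) z + koszulSign k i j • bracket y (bracket x z)

/-- The supercommutator on a `ℤ/2ℤ`-graded associative algebra: the bilinear extension of
`[x, y] = x y - (-1)^{|x||y|} y x` from homogeneous `x, y`. -/
def superCommutator {k A : Type*} [CommRing k] [Ring A] [Algebra k A]
    (𝒜 : ZMod 2 → Submodule k A) [GradedAlgebra 𝒜] (x y : A) : A :=
  ∑ i : ZMod 2, ∑ j : ZMod 2,
    ((DirectSum.decompose 𝒜 x i : A) * (DirectSum.decompose 𝒜 y j : A) -
      koszulSign k i j • ((DirectSum.decompose 𝒜 y j : A) * (DirectSum.decompose 𝒜 x i : A)))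

/-- The supercenter `{z | [z, u] = 0 for all u}` of a `ℤ/2ℤ`-graded associative algebra. -/
def superCenter {k A : Type*} [CommRing k] [Ring A] [Algebra k A]
    (𝒜 : ZMod 2 → Submodule k A) [GradedAlgebra 𝒜] : Submodule k A where
  carrier := {z | ∀ u : A, superCommutator 𝒜 z u = 0}
  zero_mem' := fun u => by simp [superCommutator]
  add_mem' := fun {a b} ha hb u => by
    have h : superCommutator 𝒜 (a + b) u = superCommutator 𝒜 a u + superCommutator 𝒜 b u := by
      simp only [superCommutator, ← Finset.sum_add_distrib]
      refine Finset.sum_congr rfl fun i _ => Finset.sum_congr rfl fun j _ => ?_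
      simp only [DirectSum.decompose_add, DirectSum.add_apply, Submodule.coe_add, add_mul, mul_add,
        smul_add]
      abel
    change superCommutator 𝒜 (a + b) u = 0
    rw [h, ha u, hb u, add_zero]
  smul_mem' := fun c a ha u => by
    have h : superCommutator 𝒜 (c • a) u = c • superCommutator 𝒜 a u := by
      simp only [superCommutator, Finset.smul_sum]
      refine Finset.sum_congr rfl fun i _ => Finset.sum_congr rfl fun j _ => ?_
      simp only [DirectSum.decompose_smul, DirectSum.smul_apply, Submodule.coe_smul,
        smul_mul_assoc, mul_smul_comm, smul_sub]
      rw [smul_comm]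
    change superCommutator 𝒜 (c • a) u = 0
    rw [h, ha u, smul_zero]

namespace LieSuperalgebra

variable {k L : Type*} [CommRing k] [AddCommGroup L] [Module k L]

/-! ### Semisimplicity -/

/-- A graded ideal: a subspace `I = (I ∩ L₀) ⊕ (I ∩ L₁)` with `[L, I] ⊆ I`. -/
structure IsGradedIdeal (S : LieSuperalgebra k L) (I : Submodule k L) : Prop where
  graded : (I ⊓ S.part 0) ⊔ (I ⊓ S.part 1) = I
  bracket_mem : ∀ x y : L, y ∈ I → S.bracket x y ∈ I

/-- The derived series `I⁽⁰⁾ = I`, `I⁽ⁿ⁺¹⁾ = [I⁽ⁿ⁾, I⁽ⁿ⁾]` (linear span of the brackets). -/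
def derivedSeries (S : LieSuperalgebra k L) (I : Submodule k L) : ℕ → Submodule k L
  | 0 => I
  | n + 1 => Submodule.map₂ S.bracket (derivedSeries S I n) (derivedSeries S I n)

/-- A Lie superalgebra is semisimple if its only solvable graded ideal is `0`. -/
def IsSemisimple (S : LieSuperalgebra k L) : Prop :=
  ∀ I : Submodule k L, S.IsGradedIdeal I → (∃ n : ℕ, S.derivedSeries I n = ⊥) → I = ⊥

/-! ### Projections to the homogeneous components -/

/-- The projection of `L` to its even (`i = 0`) or odd (`i = 1`) component. -/
def proj (S : LieSuperalgebra k L) (i : ZMod 2) : L →ₗ[k] L :=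
  if i = 0 then (S.part 0).subtype ∘ₗ (S.part 0).projectionOnto (S.part 1) S.isCompl
  else (S.part 1).subtype ∘ₗ (S.part 1).projectionOnto (S.part 0) S.isCompl.symm

theorem zmod_two_cases (i : ZMod 2) : i = 0 ∨ i = 1 := by
  revert i; decide

theorem proj_mem (S : LieSuperalgebra k L) (i : ZMod 2) (x : L) : S.proj i x ∈ S.part i := by
  rcases zmod_two_cases i with rfl | rfl <;> simp [proj]

theorem proj_same (S : LieSuperalgebra k L) {i : ZMod 2} {x : L} (hx : x ∈ S.part i) :
    S.proj i x = x := by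
  rcases zmod_two_cases i with rfl | rfl
  · rw [proj, if_pos rfl]
    exact congrArg Subtype.val (Submodule.projectionOnto_apply_left S.isCompl ⟨x, hx⟩)
  · rw [proj, if_neg one_ne_zero]
    exact congrArg Subtype.val (Submodule.projectionOnto_apply_left S.isCompl.symm ⟨x, hx⟩)

theorem proj_ne (S : LieSuperalgebra k L) {i j : ZMod 2} (hij : i ≠ j) {x : L}
    (hx : x ∈ S.part j) : S.proj i x = 0 := by
  rcases zmod_two_cases i with rfl | rfl <;> rcases zmod_two_cases j with rfl | rfl
  · exact absurd rfl hij
  · rw [proj, if_pos rfl]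
    exact congrArg Subtype.val (Submodule.projectionOnto_apply_right S.isCompl ⟨x, hx⟩)
  · rw [proj, if_neg one_ne_zero]
    exact congrArg Subtype.val (Submodule.projectionOnto_apply_right S.isCompl.symm ⟨x, hx⟩)
  · exact absurd rfl hij

theorem proj_add_proj (S : LieSuperalgebra k L) (x : L) : S.proj 0 x + S.proj 1 x = x := by
  have hx : x ∈ S.part 0 ⊔ S.part 1 := by rw [S.isCompl.sup_eq_top]; trivial
  obtain ⟨a, ha, b, hb, rfl⟩ := Submodule.mem_sup.mp hx
  rw [map_add, map_add, S.proj_same ha, S.proj_same hb, S.proj_ne zero_ne_one hb,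
    S.proj_ne one_ne_zero ha]
  simp

/-! ### Current and loop superalgebras -/

/-- The parity `i` part `L_i ⊗ A` of `L ⊗ A`. -/
def tensorPart (S : LieSuperalgebra k L) (A : Type*) [CommRing A] [Algebra k A] (i : ZMod 2) :
    Submodule k (L ⊗[k] A) :=
  LinearMap.range ((S.part i).subtype.rTensor A)

/-- The bilinear bracket `[e ⊗ a, f ⊗ b] = [e, f] ⊗ a b` on `L ⊗ A`. -/
def tensorBracket (S : LieSuperalgebra k L) (A : Type*) [CommRing A] [Algebra k A] :
    (L ⊗[k] A) →ₗ[k] (L ⊗[k] A) →ₗ[k] (L ⊗[k] A) :=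
  TensorProduct.map₂ S.bracket (LinearMap.mul k A)

@[simp] theorem tensorBracket_tmul (S : LieSuperalgebra k L) (A : Type*) [CommRing A]
    [Algebra k A] (e f : L) (a b : A) :
    S.tensorBracket A (e ⊗ₜ a) (f ⊗ₜ b) = S.bracket e f ⊗ₜ[k] (a * b) := by
  simp [tensorBracket]

theorem tmul_mem_tensorPart (S : LieSuperalgebra k L) (A : Type*) [CommRing A] [Algebra k A]
    {i : ZMod 2} {e : L} (he : e ∈ S.part i) (a : A) : e ⊗ₜ[k] a ∈ S.tensorPart A i :=
  ⟨(⟨e, he⟩ : S.part i) ⊗ₜ a, by simp⟩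

theorem tensorPart_induction (S : LieSuperalgebra k L) (A : Type*) [CommRing A] [Algebra k A]
    {i : ZMod 2} {p : L ⊗[k] A → Prop} (zero : p 0)
    (tmul : ∀ e ∈ S.part i, ∀ a : A, p (e ⊗ₜ a))
    (add : ∀ x y, p x → p y → p (x + y)) {x : L ⊗[k] A} (hx : x ∈ S.tensorPart A i) : p x := by
  obtain ⟨t, rfl⟩ := hx
  induction t with
  | zero => simpa using zero
  | tmul e a => simpa using tmul e e.2 a
  | add x y hx hy => rw [map_add]; exact add _ _ hx hy

/-- The Lie superalgebra `L ⊗ A`, for a commutative `k`-algebra `A` (placed in even degree). -/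
def tensor (S : LieSuperalgebra k L) (A : Type*) [CommRing A] [Algebra k A] :
    LieSuperalgebra k (L ⊗[k] A) where
  part := S.tensorPart A
  isCompl := by
    constructor
    · rw [Submodule.disjoint_def]
      intro x h0 h1
      have e0 : (S.proj 0).rTensor A x = x := by
        refine S.tensorPart_induction A (p := fun x => (S.proj 0).rTensor A x = x) (by simp)
          (fun e he a => ?_) (fun x y hx hy => ?_) h0
        · simp [S.proj_same he]
        · rw [map_add, hx, hy]
      have e1 : (S.proj 0).rTensor A x = 0 := by
        refine S.tensorPart_induction A (p := fun x => (S.proj 0).rTensor A x = 0) (by simp)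
          (fun e he a => ?_) (fun x y hx hy => ?_) h1
        · simp [S.proj_ne zero_ne_one he]
        · rw [map_add, hx, hy, add_zero]
      rw [← e0, e1]
    · rw [codisjoint_iff, eq_top_iff]
      intro x _
      induction x with
      | zero => exact zero_mem _
      | tmul e a =>
        rw [← S.proj_add_proj e, TensorProduct.add_tmul]
        exact add_mem
          (Submodule.mem_sup_left (S.tmul_mem_tensorPart A (S.proj_mem 0 e) a))
          (Submodule.mem_sup_right (S.tmul_mem_tensorPart A (S.proj_mem 1 e) a))
      | add x y hx hy => exact add_mem (hx trivial) (hy trivial)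
  bracket := S.tensorBracket A
  bracket_mem := by
    intro i j x y hx hy
    refine S.tensorPart_induction A (p := fun x => S.tensorBracket A x y ∈ S.tensorPart A (i + j))
      (by simp) (fun e he a => ?_) (fun x x' h h' => ?_) hx
    · refine S.tensorPart_induction A (p := fun y => S.tensorBracket A (e ⊗ₜ a) y ∈ S.tensorPart A (i + j))
        (by simp) (fun f hf b => ?_) (fun y y' h h' => ?_) hy
      · rw [tensorBracket_tmul]
        exact S.tmul_mem_tensorPart A (S.bracket_mem he hf) _
      · rw [map_add]; exact add_mem h h'
    · rw [map_add, LinearMap.add_apply]; exact add_mem h h'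
  bracket_skew := by
    intro i j x y hx hy
    refine S.tensorPart_induction A (p := fun x => S.tensorBracket A x y =
        -(koszulSign k i j • S.tensorBracket A y x))
      (by simp) (fun e he a => ?_) (fun x x' h h' => ?_) hx
    · refine S.tensorPart_induction A (p := fun y => S.tensorBracket A (e ⊗ₜ a) y =
        -(koszulSign k i j • S.tensorBracket A y (e ⊗ₜ a)))
        (by simp) (fun f hf b => ?_) (fun y y' h h' => ?_) hy
      · rw [tensorBracket_tmul, tensorBracket_tmul, S.bracket_skew he hf, TensorProduct.neg_tmul,
          ← TensorProduct.smul_tmul', mul_comm a b]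
      · rw [map_add, map_add, LinearMap.add_apply, h, h', smul_add, neg_add]
    · rw [map_add, map_add, LinearMap.add_apply, h, h', smul_add, neg_add]
  jacobi := by
    intro i j x y z hx hy
    refine S.tensorPart_induction A (p := fun x => S.tensorBracket A x (S.tensorBracket A y z) =
        S.tensorBracket A (S.tensorBracket A x y) z +
          koszulSign k i j • S.tensorBracket A y (S.tensorBracket A x z))
      (by simp) (fun e he a => ?_) (fun x x' h h' => ?_) hx
    · refine S.tensorPart_induction A (p := fun y => S.tensorBracket A (e ⊗ₜ a) (S.tensorBracket A y z) =
        S.tensorBracket A (S.tensorBracket A (e ⊗ₜ a) y) z +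
          koszulSign k i j • S.tensorBracket A y (S.tensorBracket A (e ⊗ₜ a) z))
        (by simp) (fun f hf b => ?_) (fun y y' h h' => ?_) hy
      · induction z with
        | zero => simp
        | tmul g c =>
          simp only [tensorBracket_tmul]
          rw [S.jacobi g he hf, TensorProduct.add_tmul, ← TensorProduct.smul_tmul', mul_assoc,
            mul_left_comm b a c]
        | add z z' h h' => simp only [map_add, h, h', smul_add]; abel
      · simp only [map_add, LinearMap.add_apply, h, h', smul_add]; abel
    · simp only [map_add, LinearMap.add_apply, h, h', smul_add]; abel

/-- The current superalgebra `L[x] = L ⊗ k[x]`. -/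
def current (S : LieSuperalgebra k L) : LieSuperalgebra k (L ⊗[k] k[X]) := S.tensor k[X]

/-- The loop superalgebra `L(x) = L ⊗ k[x, x⁻¹]`. -/
def loop (S : LieSuperalgebra k L) : LieSuperalgebra k (L ⊗[k] k[T;T⁻¹]) := S.tensor k[T;T⁻¹]

/-! ### The universal enveloping superalgebra -/

/-- The relations `x y = [x, y] + (-1)^{|x||y|} y x`, for homogeneous `x, y`. -/
inductive EnvelopingRel (S : LieSuperalgebra k L) : TensorAlgebra k L → TensorAlgebra k L → Prop
  | comm {i j : ZMod 2} {x y : L} (hx : x ∈ S.part i) (hy : y ∈ S.part j) :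
      EnvelopingRel S
        (TensorAlgebra.ι k x * TensorAlgebra.ι k y)
        (TensorAlgebra.ι k (S.bracket x y) +
          koszulSign k i j • (TensorAlgebra.ι k y * TensorAlgebra.ι k x))

/-- The universal enveloping algebra `U(L)`: the tensor algebra of `L` modulo the two-sided ideal
generated by `x y - (-1)^{|x||y|} y x - [x, y]`, for homogeneous `x, y`. -/
def Enveloping (S : LieSuperalgebra k L) : Type _ := RingQuot (EnvelopingRel S)

instance (S : LieSuperalgebra k L) : Ring (Enveloping S) :=
  inferInstanceAs (Ring (RingQuot (EnvelopingRel S)))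

instance (S : LieSuperalgebra k L) : Algebra k (Enveloping S) :=
  inferInstanceAs (Algebra k (RingQuot (EnvelopingRel S)))

namespace Enveloping

variable (S : LieSuperalgebra k L)

/-- The quotient map from the tensor algebra. -/
def mk : TensorAlgebra k L →ₐ[k] Enveloping S := RingQuot.mkAlgHom k (EnvelopingRel S)

/-- The canonical map `L → U(L)`. -/
def ι : L →ₗ[k] Enveloping S := (mk S).toLinearMap ∘ₗ TensorAlgebra.ι k

theorem ι_comm {i j : ZMod 2} {x y : L} (hx : x ∈ S.part i) (hy : y ∈ S.part j) :
    ι S x * ι S y = ι S (S.bracket x y) + koszulSign k i j • (ι S y * ι S x) := by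
  have h : mk S _ = mk S _ := RingQuot.mkAlgHom_rel k (EnvelopingRel.comm hx hy)
  rw [map_mul, map_add, map_smul, map_mul] at h
  exact h

/-- The existence part of the universal property of `U(L)`. -/
def lift {A : Type*} [Semiring A] [Algebra k A] (f : L →ₗ[k] A)
    (hf : ∀ {i j : ZMod 2} {x y : L}, x ∈ S.part i → y ∈ S.part j →
      f x * f y = f (S.bracket x y) + koszulSign k i j • (f y * f x)) :
    Enveloping S →ₐ[k] A :=
  RingQuot.liftAlgHom k ⟨TensorAlgebra.lift k f, by
    rintro _ _ ⟨hx, hy⟩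
    simpa only [map_add, map_mul, map_smul, TensorAlgebra.lift_ι_apply] using hf hx hy⟩

theorem lift_ι {A : Type*} [Semiring A] [Algebra k A] (f : L →ₗ[k] A)
    (hf : ∀ {i j : ZMod 2} {x y : L}, x ∈ S.part i → y ∈ S.part j →
      f x * f y = f (S.bracket x y) + koszulSign k i j • (f y * f x)) (x : L) :
    lift S f hf (ι S x) = f x := by
  have h := RingQuot.liftAlgHom_mkAlgHom_apply k (TensorAlgebra.lift k f)
    (s := EnvelopingRel S) (by
      rintro _ _ ⟨hx, hy⟩
      simpa only [map_add, map_mul, map_smul, TensorAlgebra.lift_ι_apply] using hf hx hy)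
    (TensorAlgebra.ι k x)
  rw [TensorAlgebra.lift_ι_apply] at h
  exact h

variable {S} in
/-- The uniqueness part of the universal property of `U(L)`. -/
theorem hom_ext {A : Type*} [Semiring A] [Algebra k A] {f g : Enveloping S →ₐ[k] A}
    (h : ∀ x, f (ι S x) = g (ι S x)) : f = g := by
  apply RingQuot.ringQuot_ext'
  apply TensorAlgebra.hom_ext
  ext x
  exact h x

/-- The parity `i` part of `U(L)`: the span of the products `x₁ ⋯ xₙ` (`n ≥ 0`) of homogeneous
elements of `L` whose parities sum to `i`. -/
def part (i : ZMod 2) : Submodule k (Enveloping S) :=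
  Submodule.span k {u | ∃ l : List (ZMod 2 × L), (∀ p ∈ l, p.2 ∈ S.part p.1) ∧
    (l.map Prod.fst).sum = i ∧ (l.map fun p => ι S p.2).prod = u}

theorem ι_mem_part {i : ZMod 2} {x : L} (hx : x ∈ S.part i) : ι S x ∈ part S i :=
  Submodule.subset_span ⟨[(i, x)], by simpa using hx, by simp, by simp⟩

instance gradedMonoid : SetLike.GradedMonoid (part S) where
  one_mem := Submodule.subset_span ⟨[], by simp, by simp, by simp⟩
  mul_mem := by
    intro i j u v hu hv
    have h : part S i * part S j ≤ part S (i + j) := by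
      rw [part, part, Submodule.span_mul_span, Submodule.span_le]
      rintro _ ⟨_, ⟨l, hl, rfl, rfl⟩, _, ⟨l', hl', rfl, rfl⟩, rfl⟩
      refine Submodule.subset_span ⟨l ++ l', ?_, by simp, by simp⟩
      intro p hp
      rcases List.mem_append.mp hp with hp | hp
      · exact hl p hp
      · exact hl' p hp
    exact h (Submodule.mul_mem_mul hu hv)

/-- Auxiliary map `L_i → U(L)_i` composed with the projection `L → L_i`. -/
def ιPart (i : ZMod 2) : L →ₗ[k] part S i :=
  (ι S ∘ₗ S.proj i).codRestrict (part S i) fun x => ι_mem_part S (S.proj_mem i x)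

/-- Auxiliary map `L → U(L)₀ ⊕ U(L)₁`. -/
def ιSum : L →ₗ[k] ⨁ i, part S i :=
  DirectSum.lof k (ZMod 2) (fun i => part S i) 0 ∘ₗ ιPart S 0 +
    DirectSum.lof k (ZMod 2) (fun i => part S i) 1 ∘ₗ ιPart S 1

theorem ιSum_of_mem {i : ZMod 2} {x : L} (hx : x ∈ S.part i) :
    ιSum S x = DirectSum.of (fun i => part S i) i ⟨ι S x, ι_mem_part S hx⟩ := by
  have hs : ιPart S i x = ⟨ι S x, ι_mem_part S hx⟩ :=
    Subtype.ext (by simp [ιPart, S.proj_same hx])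
  have hn : ∀ j, j ≠ i → ιPart S j x = 0 := fun j hj =>
    Subtype.ext (by simp [ιPart, S.proj_ne hj hx])
  rcases zmod_two_cases i with rfl | rfl
  · simp [ιSum, hs, hn 1 one_ne_zero, DirectSum.lof_eq_of]
  · simp [ιSum, hs, hn 0 zero_ne_one, DirectSum.lof_eq_of]

theorem of_congr {i j : ZMod 2} (h : i = j) {u v : Enveloping S} (huv : u = v)
    (hu : u ∈ part S i) (hv : v ∈ part S j) :
    DirectSum.of (fun i => part S i) i ⟨u, hu⟩ = DirectSum.of (fun i => part S i) j ⟨v, hv⟩ := by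
  subst h; subst huv; rfl

theorem ιSum_comm {i j : ZMod 2} {x y : L} (hx : x ∈ S.part i) (hy : y ∈ S.part j) :
    ιSum S x * ιSum S y = ιSum S (S.bracket x y) + koszulSign k i j • (ιSum S y * ιSum S x) := by
  have hxy : ι S y * ι S x ∈ part S (i + j) := by
    rw [add_comm]
    exact SetLike.GradedMul.mul_mem (ι_mem_part S hy) (ι_mem_part S hx)
  have e : ιSum S y * ιSum S x =
      DirectSum.lof k (ZMod 2) (fun i => part S i) (i + j) ⟨ι S y * ι S x, hxy⟩ := by
    rw [ιSum_of_mem S hx, ιSum_of_mem S hy, DirectSum.of_mul_of]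
    exact of_congr S (add_comm j i) rfl _ _
  rw [e, ιSum_of_mem S hx, ιSum_of_mem S hy, ιSum_of_mem S (S.bracket_mem hx hy),
    DirectSum.of_mul_of, ← DirectSum.lof_eq_of k, ← DirectSum.lof_eq_of k, ← map_smul, ← map_add]
  exact of_congr S rfl (ι_comm S hx hy) _ _

theorem lift_ιSum_prod (l : List (ZMod 2 × L)) (hl : ∀ p ∈ l, p.2 ∈ S.part p.1)
    (hm : (l.map fun p => ι S p.2).prod ∈ part S (l.map Prod.fst).sum) :
    lift S (ιSum S) (ιSum_comm S) (l.map fun p => ι S p.2).prod =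
      DirectSum.of (fun i => part S i) (l.map Prod.fst).sum ⟨_, hm⟩ := by
  induction l with
  | nil =>
    refine (map_one (lift S (ιSum S) (ιSum_comm S))).trans ?_
    exact of_congr S rfl rfl _ _
  | cons p l ih =>
    have hp : p.2 ∈ S.part p.1 := hl p (by simp)
    have hl' : ∀ q ∈ l, q.2 ∈ S.part q.1 := fun q hq => hl q (by simp [hq])
    have h := ih hl' (Submodule.subset_span ⟨l, hl', rfl, rfl⟩)
    simp only [List.map_cons, List.prod_cons, map_mul, lift_ι]
    rw [h, ιSum_of_mem S hp, DirectSum.of_mul_of]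
    exact of_congr S (by simp) (by simp) _ _

/-- `U(L)` is an associative superalgebra. -/
instance gradedAlgebra : GradedAlgebra (part S) :=
  GradedAlgebra.ofAlgHom (part S) (lift S (ιSum S) (ιSum_comm S))
    (by
      apply hom_ext
      intro x
      have h : ιSum S x = ιSum S (S.proj 0 x) + ιSum S (S.proj 1 x) := by
        rw [← map_add, S.proj_add_proj]
      rw [AlgHom.comp_apply, lift_ι, h, ιSum_of_mem S (S.proj_mem 0 x),
        ιSum_of_mem S (S.proj_mem 1 x), map_add, DirectSum.coeAlgHom_of, DirectSum.coeAlgHom_of,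
        ← map_add, S.proj_add_proj]
      rfl)
    (by
      rintro i ⟨u, hu⟩
      induction hu using Submodule.span_induction with
      | mem u hu =>
        obtain ⟨l, hl, rfl, rfl⟩ := hu
        exact lift_ιSum_prod S l hl _
      | zero => rw [map_zero]; exact (map_zero (DirectSum.of (fun i => part S i) i)).symm
      | add u v hu hv h h' =>
        rw [map_add, h, h', ← map_add]; rfl
      | smul c u hu h =>
        rw [map_smul, h, ← DirectSum.lof_eq_of k, ← map_smul]; rfl)

end Enveloping

/-- The center `Z(L)` of the universal enveloping algebra `U(L)`, in the super sense:
`{z | [z, u] = 0 for all u}` for the supercommutator `[z, u] = z u - (-1)^{|z||u|} u z`. -/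
def envelopingCenter (S : LieSuperalgebra k L) : Submodule k (Enveloping S) :=
  superCenter (Enveloping.part S)

end LieSuperalgebra

end

noncomputable section

/-! Write `g = L ⊗ A` with `A` the (Laurent) polynomials, and let `F_m` be the span of the words of
length at most `m` in `U(g)`. Up to parity signs, the algebra map `coaction : U(g) → U(g) ⊗ End g`
is comultiplication followed by the adjoint representation on the second factor. For `z` of parity
`i` in `F_n` it has the shape `z ⊗ P^i`, plus a part linear in `ad` encoded by some `t ∈ F_{n-1} ⊗
g`, plus a remainder in `F_{n-2} ⊗ End g`; and multiplying out `t` gives `n z` modulo `F_{n-1}`, a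
form of Euler's formula (`exists_isLinearPart`). All of this takes place modulo shorter words inside
`U(g)`, so the Poincaré–Birkhoff–Witt theorem is not needed.

Let `z` supercommute with every `u = e ⊗ x^r`. Apply `coaction` to this relation, contract the first
factor with a functional `φ` that vanishes on `F_{n-2}`, and evaluate at `f ⊗ 1`
(`contractFst_commutator`). One side is a combination of finitely many elements of `g` in which only
the scalars depend on `r`. The other side is, up to signs on parity components, `[[u, y], f ⊗ 1]`
with `y = φ(t)`. The coefficient of `x^(s+r)` for large `r` vanishes on the first side and is `[[e,
y_s], f]` on the second. A semisimple `L` has no center, so every `y_s` is zero and `y = 0`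
(`contractFst_eq_zero`). Since `φ` was arbitrary, `t ∈ F_{n-2} ⊗ g`; hence `n z ∈ F_{n-1}`, and in
characteristic `0` induction on `n` brings `z` down to `F_0 = k`
(`mem_range_algebraMap_of_supercommute`). -/

theorem koszulSign_zero_left (k : Type*) [CommRing k] (i : ZMod 2) : koszulSign k 0 i = 1 := by
  simp [koszulSign]

theorem koszulSign_zero_right (k : Type*) [CommRing k] (i : ZMod 2) : koszulSign k i 0 = 1 := by
  simp [koszulSign]

theorem koszulSign_one_one (k : Type*) [CommRing k] : koszulSign k 1 1 = -1 := by
  simp [koszulSign, ZMod.val_one]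

theorem koszulSign_mul_self (k : Type*) [CommRing k] (i j : ZMod 2) :
    koszulSign k i j * koszulSign k i j = 1 := by
  rw [koszulSign, ← mul_pow]; simp

theorem eq_zero_of_koszulSign_smul {k V : Type*} [CommRing k] [AddCommGroup V] [Module k V]
    {i j : ZMod 2} {v : V} (h : koszulSign k i j • v = 0) : v = 0 := by
  rw [← one_smul k v, ← koszulSign_mul_self k i j, mul_smul, h, smul_zero]

theorem koszulSign_add_left (k : Type*) [CommRing k] (i j l : ZMod 2) :
    koszulSign k (i + j) l = koszulSign k i l * koszulSign k j l := by
  have h : (1 : ZMod 2) + 1 = 0 := rfl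
  rcases LieSuperalgebra.zmod_two_cases i with rfl | rfl <;>
    rcases LieSuperalgebra.zmod_two_cases j with rfl | rfl <;>
    rcases LieSuperalgebra.zmod_two_cases l with rfl | rfl <;>
    simp [koszulSign_zero_left, koszulSign_zero_right, koszulSign_one_one, h]

theorem koszulSign_add_right (k : Type*) [CommRing k] (i j l : ZMod 2) :
    koszulSign k i (j + l) = koszulSign k i j * koszulSign k i l := by
  rw [koszulSign_comm, koszulSign_add_left, koszulSign_comm k j, koszulSign_comm k l]

namespace LieSuperalgebra

section Generic

variable {k L : Type*} [CommRing k] [AddCommGroup L] [Module k L] (S : LieSuperalgebra k L)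

/-! ### The adjoint representation and the parity operator -/

theorem linearMap_ext {V : Type*} [AddCommGroup V] [Module k V] {f g : L →ₗ[k] V}
    (h : ∀ j, ∀ x ∈ S.part j, f x = g x) : f = g := by
  ext x
  rw [← S.proj_add_proj x, map_add, map_add, h 0 _ (S.proj_mem 0 x), h 1 _ (S.proj_mem 1 x)]

theorem eq_zero_of_add_eq_zero {i : ZMod 2} {x y : L} (hx : x ∈ S.part i)
    (hy : y ∈ S.part (i + 1)) (h : x + y = 0) : x = 0 ∧ y = 0 := by
  have hi : i ≠ i + 1 := by simp
  have hx0 : x = 0 := by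
    have := congrArg (S.proj i) h
    rwa [map_add, S.proj_same hx, S.proj_ne hi hy, map_zero, add_zero] at this
  refine ⟨hx0, ?_⟩
  rwa [hx0, zero_add] at h

/-- The adjoint representation. -/
def ad : L →ₗ[k] Module.End k L := S.bracket

theorem ad_apply (x y : L) : S.ad x y = S.bracket x y := rfl

theorem ad_mul_ad {i j : ZMod 2} {x y : L} (hx : x ∈ S.part i) (hy : y ∈ S.part j) :
    S.ad x * S.ad y = S.ad (S.bracket x y) + koszulSign k i j • (S.ad y * S.ad x) :=
  LinearMap.ext fun z => S.jacobi z hx hy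

/-- The `i`-th power of the parity operator, acting on `L_j` as the sign `(-1)^{ij}`. -/
def parity (i : ZMod 2) : Module.End k L := S.proj 0 + koszulSign k i 1 • S.proj 1

theorem parity_apply {i j : ZMod 2} {x : L} (hx : x ∈ S.part j) :
    S.parity i x = koszulSign k i j • x := by
  rcases zmod_two_cases j with rfl | rfl
  · simp [parity, S.proj_same hx, S.proj_ne one_ne_zero hx, koszulSign_zero_right]
  · simp [parity, S.proj_same hx, S.proj_ne zero_ne_one hx]

theorem parity_zero : S.parity 0 = 1 :=
  S.linearMap_ext fun j x hx => by simp [S.parity_apply hx, koszulSign_zero_left]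

theorem parity_add (i j : ZMod 2) : S.parity (i + j) = S.parity i * S.parity j :=
  S.linearMap_ext fun l x hx => by
    rw [Module.End.mul_apply, S.parity_apply hx, S.parity_apply hx, map_smul, S.parity_apply hx,
      smul_smul, koszulSign_add_left, mul_comm]

theorem parity_mul_ad (i : ZMod 2) {j : ZMod 2} {y : L} (hy : y ∈ S.part j) :
    S.parity i * S.ad y = koszulSign k i j • (S.ad y * S.parity i) :=
  S.linearMap_ext fun l x hx => by
    rw [Module.End.mul_apply, LinearMap.smul_apply, Module.End.mul_apply, S.parity_apply hx,
      map_smul, ad_apply, S.parity_apply (S.bracket_mem hy hx), smul_smul, koszulSign_add_right]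

theorem ad_mul_parity (i : ZMod 2) {j : ZMod 2} {y : L} (hy : y ∈ S.part j) :
    S.ad y * S.parity i = koszulSign k i j • (S.parity i * S.ad y) := by
  rw [S.parity_mul_ad i hy, smul_smul, koszulSign_mul_self, one_smul]

/-- The adjoint representation twisted by parity: `y ↦ P^{|y|} ad y`. -/
def twistedAd : L →ₗ[k] Module.End k L :=
  S.ad ∘ₗ S.proj 0 + LinearMap.mulLeft k (S.parity 1) ∘ₗ S.ad ∘ₗ S.proj 1

theorem twistedAd_apply (y : L) :
    S.twistedAd y = S.ad (S.proj 0 y) + S.parity 1 * S.ad (S.proj 1 y) := rfl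

theorem twistedAd_of_mem {j : ZMod 2} {y : L} (hy : y ∈ S.part j) :
    S.twistedAd y = S.parity j * S.ad y := by
  rcases zmod_two_cases j with rfl | rfl
  · simp [twistedAd_apply, S.proj_same hy, S.proj_ne one_ne_zero hy, parity_zero]
  · simp [twistedAd_apply, S.proj_same hy, S.proj_ne zero_ne_one hy]

namespace Enveloping

/-! ### The coaction of `U(L)` on the adjoint representation -/

/-- The linear map underlying `coaction`. -/
def coactionAux : L →ₗ[k] Enveloping S ⊗[k] Module.End k L :=
  (TensorProduct.mk k (Enveloping S) (Module.End k L)).flip 1 ∘ₗ ι S ∘ₗ S.proj 0 +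
    (TensorProduct.mk k (Enveloping S) (Module.End k L)).flip (S.parity 1) ∘ₗ ι S ∘ₗ S.proj 1 +
    TensorProduct.mk k (Enveloping S) (Module.End k L) 1 ∘ₗ S.ad

theorem coactionAux_of_mem {j : ZMod 2} {x : L} (hx : x ∈ S.part j) :
    coactionAux S x = ι S x ⊗ₜ S.parity j + 1 ⊗ₜ S.ad x := by
  rcases zmod_two_cases j with rfl | rfl
  · simp [coactionAux, S.proj_same hx, S.proj_ne one_ne_zero hx, parity_zero]
  · simp [coactionAux, S.proj_same hx, S.proj_ne zero_ne_one hx]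

/-- The diagonal terms give the defining relation of `U(L)` and the Jacobi identity. The cross terms
match because moving `P^i` past `ad y` costs exactly the Koszul sign: the parity operators let the
ordinary tensor product imitate the super one. -/
theorem coactionAux_comm {i j : ZMod 2} {x y : L} (hx : x ∈ S.part i) (hy : y ∈ S.part j) :
    coactionAux S x * coactionAux S y = coactionAux S (S.bracket x y) +
      koszulSign k i j • (coactionAux S y * coactionAux S x) := by
  rw [coactionAux_of_mem S hx, coactionAux_of_mem S hy,
    coactionAux_of_mem S (S.bracket_mem hx hy)]
  simp only [add_mul, mul_add, Algebra.TensorProduct.tmul_mul_tmul, one_mul, mul_one]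
  rw [ι_comm S hx hy, S.ad_mul_ad hx hy, S.parity_mul_ad i hy, S.ad_mul_parity j hx,
    S.parity_add, koszulSign_comm k j i]
  have hc : S.parity j * S.parity i = S.parity i * S.parity j := by
    rw [← S.parity_add, ← S.parity_add, add_comm]
  rw [hc]
  simp only [TensorProduct.add_tmul, TensorProduct.tmul_add, TensorProduct.tmul_smul,
    ← TensorProduct.smul_tmul', smul_add]
  abel

/-- The algebra map `U(L) → U(L) ⊗ End L`, sending a homogeneous `x ∈ L` to
`x ⊗ P^{|x|} + 1 ⊗ ad x`, where `P` is the parity operator. -/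
def coaction : Enveloping S →ₐ[k] Enveloping S ⊗[k] Module.End k L :=
  lift S (coactionAux S) (coactionAux_comm S)

theorem coaction_ι {j : ZMod 2} {x : L} (hx : x ∈ S.part j) :
    coaction S (ι S x) = ι S x ⊗ₜ S.parity j + 1 ⊗ₜ S.ad x := by
  rw [coaction, lift_ι, coactionAux_of_mem S hx]

/-! ### The filtration by word length -/

/-- The span of the products of fewer than `n` homogeneous elements of `L`. -/
def filtration (n : ℕ) : Submodule k (Enveloping S) :=
  Submodule.span k {u | ∃ l : List (ZMod 2 × L), (∀ p ∈ l, p.2 ∈ S.part p.1) ∧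
    l.length < n ∧ (l.map fun p => ι S p.2).prod = u}

/-- The span of the products of at most `n` homogeneous elements of `L` of total parity `i`. -/
def filtrationPart (n : ℕ) (i : ZMod 2) : Submodule k (Enveloping S) :=
  Submodule.span k {u | ∃ l : List (ZMod 2 × L), (∀ p ∈ l, p.2 ∈ S.part p.1) ∧
    l.length ≤ n ∧ (l.map Prod.fst).sum = i ∧ (l.map fun p => ι S p.2).prod = u}

variable {S}

theorem prod_mem_filtration {l : List (ZMod 2 × L)} (hl : ∀ p ∈ l, p.2 ∈ S.part p.1) {n : ℕ}
    (hn : l.length < n) : (l.map fun p => ι S p.2).prod ∈ filtration S n :=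
  Submodule.subset_span ⟨l, hl, hn, rfl⟩

theorem filtration_mono {m n : ℕ} (h : m ≤ n) : filtration S m ≤ filtration S n :=
  Submodule.span_mono fun _ ⟨l, hl, hm, e⟩ => ⟨l, hl, hm.trans_le h, e⟩

theorem ι_mul_mem_filtration (x : L) {n : ℕ} {u : Enveloping S} (hu : u ∈ filtration S n) :
    ι S x * u ∈ filtration S (n + 1) := by
  induction hu using Submodule.span_induction with
  | mem u hu =>
    obtain ⟨l, hl, hn, rfl⟩ := hu
    have h : ∀ i, ι S (S.proj i x) * (l.map fun p => ι S p.2).prod ∈ filtration S (n + 1) :=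
      fun i => Submodule.subset_span ⟨(i, S.proj i x) :: l, by
        simpa using ⟨S.proj_mem i x, fun a b h => hl (a, b) h⟩, by simpa using hn, by simp⟩
    rw [← S.proj_add_proj x, map_add, add_mul]
    exact add_mem (h 0) (h 1)
  | zero => simp
  | add u v _ _ h h' => rw [mul_add]; exact add_mem h h'
  | smul c u _ h => rw [mul_smul_comm]; exact Submodule.smul_mem _ _ h

theorem mul_ι_mem_filtration (x : L) {n : ℕ} {u : Enveloping S} (hu : u ∈ filtration S n) :
    u * ι S x ∈ filtration S (n + 1) := by
  induction hu using Submodule.span_induction with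
  | mem u hu =>
    obtain ⟨l, hl, hn, rfl⟩ := hu
    have h : ∀ i, (l.map fun p => ι S p.2).prod * ι S (S.proj i x) ∈ filtration S (n + 1) :=
      fun i => Submodule.subset_span ⟨l ++ [(i, S.proj i x)], by
        intro p hp
        rcases List.mem_append.mp hp with hp | hp
        · exact hl p hp
        · rw [List.mem_singleton.mp hp]; exact S.proj_mem i x, by simpa using hn, by simp⟩
    rw [← S.proj_add_proj x, map_add, mul_add]
    exact add_mem (h 0) (h 1)
  | zero => simp
  | add u v _ _ h h' => rw [add_mul]; exact add_mem h h'
  | smul c u _ h => rw [smul_mul_assoc]; exact Submodule.smul_mem _ _ h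

theorem filtration_zero : filtration S 0 = ⊥ := by
  simp [filtration]

/-- Truncated subtraction is harmless at `n = 0`, since the filtration starts with the zero
submodule. -/
theorem ι_mul_mem_filtration_pred (x : L) {n : ℕ} {u : Enveloping S}
    (hu : u ∈ filtration S (n - 1)) : ι S x * u ∈ filtration S n := by
  cases n with
  | zero =>
    rw [Nat.zero_sub, filtration_zero, Submodule.mem_bot] at hu
    simp [hu]
  | succ n => exact ι_mul_mem_filtration x hu

/-- Elements of `L` supercommute with words up to shorter words. -/
theorem ι_mul_prod_sub_mem {j : ZMod 2} {x : L} (hx : x ∈ S.part j) {l : List (ZMod 2 × L)}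
    (hl : ∀ p ∈ l, p.2 ∈ S.part p.1) :
    ι S x * (l.map fun p => ι S p.2).prod - koszulSign k (l.map Prod.fst).sum j •
      ((l.map fun p => ι S p.2).prod * ι S x) ∈ filtration S (l.length + 1) := by
  induction l with
  | nil => simp [koszulSign_zero_left]
  | cons p l ih =>
    have hp : p.2 ∈ S.part p.1 := hl p (by simp)
    have hl' : ∀ q ∈ l, q.2 ∈ S.part q.1 := fun q hq => hl q (by simp [hq])
    -- Move `x` past the first letter `p`: this leaves the shorter word that starts with `[x, p]`,
    -- and `p` times the induction hypothesis.
    have h1 := ι_mul_mem_filtration (S.bracket x p.2)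
      (prod_mem_filtration hl' (Nat.lt_succ_self l.length))
    have h2 := Submodule.smul_mem _ (koszulSign k p.1 j) (ι_mul_mem_filtration p.2 (ih hl'))
    rw [List.length_cons]
    convert add_mem h1 h2 using 1
    simp only [List.map_cons, List.prod_cons, List.sum_cons]
    rw [← mul_assoc, ι_comm S hx hp, koszulSign_add_left, koszulSign_comm k j p.1]
    simp only [add_mul, mul_sub, smul_sub, smul_mul_assoc, mul_smul_comm, smul_smul, mul_assoc]
    abel

/-! ### The linear part of the coaction and Euler's formula. -/

/-- Multiplication `U(L) ⊗ L → U(L)`. -/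
def mulRight (S : LieSuperalgebra k L) : Enveloping S ⊗[k] L →ₗ[k] Enveloping S :=
  TensorProduct.lift ((LinearMap.mul k (Enveloping S)).compl₂ (ι S))

theorem mulRight_tmul (u : Enveloping S) (x : L) : mulRight S (u ⊗ₜ x) = u * ι S x := by
  simp [mulRight]

/-- The linear map `U(L) ⊗ L → U(L) ⊗ End L`, `u ⊗ y ↦ u ⊗ P^{i + |y|} ad y`. -/
def twistedAdTensor (S : LieSuperalgebra k L) (i : ZMod 2) :
    Enveloping S ⊗[k] L →ₗ[k] Enveloping S ⊗[k] Module.End k L :=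
  LinearMap.lTensor _ (LinearMap.mulLeft k (S.parity i) ∘ₗ S.twistedAd)

theorem twistedAdTensor_tmul (i : ZMod 2) (u : Enveloping S) (y : L) :
    twistedAdTensor S i (u ⊗ₜ y) = u ⊗ₜ (S.parity i * S.twistedAd y) := rfl

theorem tmul_mul_twistedAdTensor (x : Enveloping S) (j i : ZMod 2) (t : Enveloping S ⊗[k] L) :
    (x ⊗ₜ S.parity j) * twistedAdTensor S i t =
      twistedAdTensor S (j + i) (LinearMap.rTensor L (LinearMap.mulLeft k x) t) := by
  induction t with
  | zero => simp
  | tmul u y =>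
    simp only [twistedAdTensor_tmul, LinearMap.rTensor_tmul, LinearMap.mulLeft_apply,
      Algebra.TensorProduct.tmul_mul_tmul, S.parity_add, mul_assoc]
  | add t t' h h' => simp only [map_add, mul_add, h, h']

theorem mulRight_rTensor_mulLeft (x : Enveloping S) (t : Enveloping S ⊗[k] L) :
    mulRight S (LinearMap.rTensor L (LinearMap.mulLeft k x) t) = x * mulRight S t := by
  induction t with
  | zero => simp
  | tmul u y => simp [mulRight_tmul, mul_assoc]
  | add t t' h h' => simp only [map_add, mul_add, h, h']

/-- The submodule of `U(L) ⊗ V` generated by `w ⊗ v` with `w` of length less than `n`. -/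
abbrev filtrationTensor (S : LieSuperalgebra k L) (V : Type*) [AddCommGroup V] [Module k V]
    (n : ℕ) : Submodule k (Enveloping S ⊗[k] V) :=
  Submodule.map₂ (TensorProduct.mk k (Enveloping S) V) (filtration S n) ⊤

theorem tmul_mem_filtrationTensor {V : Type*} [AddCommGroup V] [Module k V] {n : ℕ}
    {u : Enveloping S} (hu : u ∈ filtration S n) (v : V) :
    u ⊗ₜ v ∈ filtrationTensor S V n :=
  Submodule.apply_mem_map₂ _ hu trivial

theorem filtrationTensor_mono {V : Type*} [AddCommGroup V] [Module k V] {m n : ℕ} (h : m ≤ n) :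
    filtrationTensor S V m ≤ filtrationTensor S V n :=
  Submodule.map₂_le_map₂_left (filtration_mono h)

theorem mem_of_mem_filtrationTensor {V W : Type*} [AddCommGroup V] [Module k V] [AddCommGroup W]
    [Module k W] {n : ℕ} {p : Submodule k W} {f : Enveloping S ⊗[k] V →ₗ[k] W}
    (h : ∀ u ∈ filtration S n, ∀ v, f (u ⊗ₜ v) ∈ p) {t : Enveloping S ⊗[k] V}
    (ht : t ∈ filtrationTensor S V n) : f t ∈ p := by
  have : filtrationTensor S V n ≤ p.comap f := Submodule.map₂_le.mpr fun u hu v _ => h u hu v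
  exact this ht

/-- `t` is the linear part of the coaction on `z`, up to terms of lower length. -/
structure IsLinearPart (n : ℕ) (i : ZMod 2) (z : Enveloping S) (t : Enveloping S ⊗[k] L) :
    Prop where
  mem : t ∈ filtrationTensor S L n
  coaction_sub : coaction S z - z ⊗ₜ S.parity i - twistedAdTensor S i t ∈
    filtrationTensor S (Module.End k L) (n - 1)
  mulRight_sub : mulRight S t - (n : k) • z ∈ filtration S n

/-- Expanding the product of the factors `x ⊗ P^{|x|} + 1 ⊗ ad x`, the linear part collects the
terms where exactly one letter acts through `ad`. Multiplying out moves that letter to the right end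
of the word; up to shorter words and a sign absorbed in `t`, each of the letters gives back the word
itself. -/
theorem exists_isLinearPart_prod {l : List (ZMod 2 × L)} (hl : ∀ p ∈ l, p.2 ∈ S.part p.1) :
    ∃ t, IsLinearPart l.length (l.map Prod.fst).sum (l.map fun p => ι S p.2).prod t := by
  induction l with
  | nil =>
    refine ⟨0, zero_mem _, ?_, ?_⟩
    · simp [parity_zero, Algebra.TensorProduct.one_def]
    · simp
  | cons p l ih =>
    have hp : p.2 ∈ S.part p.1 := hl p (by simp)
    have hl' : ∀ q ∈ l, q.2 ∈ S.part q.1 := fun q hq => hl q (by simp [hq])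
    obtain ⟨t, h1, h2, h3⟩ := ih hl'
    have hz := prod_mem_filtration hl' (Nat.lt_succ_self l.length)
    have hc := ι_mul_prod_sub_mem hp hl'
    simp only [List.map_cons, List.prod_cons, List.sum_cons, List.length_cons]
    generalize (l.map fun p => ι S p.2).prod = z at *
    generalize (l.map Prod.fst).sum = i at *
    generalize l.length = n at *
    obtain ⟨j, x⟩ := p
    simp only at *
    set R := coaction S z - z ⊗ₜ S.parity i - twistedAdTensor S i t with hR
    have hRz : coaction S z = z ⊗ₜ S.parity i + twistedAdTensor S i t + R := by rw [hR]; abel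
    -- The letter acting through `ad` is either in the tail (first summand) or it is `x` itself,
    -- whose passage across the tail `z` gives the sign.
    refine ⟨LinearMap.rTensor L (LinearMap.mulLeft k (ι S x)) t + koszulSign k i j • z ⊗ₜ x,
      ?_, ?_, ?_⟩
    · refine add_mem (mem_of_mem_filtrationTensor (fun u hu v => ?_) h1)
        (Submodule.smul_mem _ _ (tmul_mem_filtrationTensor hz x))
      exact tmul_mem_filtrationTensor (ι_mul_mem_filtration x hu) v
    · have e1 := tmul_mul_twistedAdTensor (ι S x) j i t
      -- The twist `P^j` built into `twistedAd` cancels the extra `P^j` in `P^(j+i)`, because `2j =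
      -- 0` in `ZMod 2`.
      have e2 : (1 ⊗ₜ S.ad x) * (z ⊗ₜ S.parity i) =
          twistedAdTensor S (j + i) (koszulSign k i j • z ⊗ₜ x) := by
        rw [map_smul, twistedAdTensor_tmul, Algebra.TensorProduct.tmul_mul_tmul, one_mul,
          S.ad_mul_parity i hp, S.twistedAd_of_mem hp, ← mul_assoc, ← S.parity_add,
          add_right_comm, CharTwo.add_self_eq_zero, zero_add, TensorProduct.tmul_smul]
      -- The remaining products `e3`, `e4`, `e5` are the error terms: either a second letter acts
      -- through `ad`, or a factor comes from the remainder `R`.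
      have e3 : (1 ⊗ₜ S.ad x) * twistedAdTensor S i t ∈ filtrationTensor S (Module.End k L) n :=
        mem_of_mem_filtrationTensor
          (f := LinearMap.mulLeft k (1 ⊗ₜ S.ad x) ∘ₗ twistedAdTensor S i) (fun u hu v => by
            rw [LinearMap.comp_apply, twistedAdTensor_tmul, LinearMap.mulLeft_apply,
              Algebra.TensorProduct.tmul_mul_tmul, one_mul]
            exact tmul_mem_filtrationTensor hu _) h1
      have e4 : (ι S x ⊗ₜ S.parity j) * R ∈ filtrationTensor S (Module.End k L) n :=
        mem_of_mem_filtrationTensor (f := LinearMap.mulLeft k (ι S x ⊗ₜ S.parity j))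
          (fun u hu v => by
            rw [LinearMap.mulLeft_apply, Algebra.TensorProduct.tmul_mul_tmul]
            exact tmul_mem_filtrationTensor (ι_mul_mem_filtration_pred x hu) _) h2
      have e5 : (1 ⊗ₜ S.ad x) * R ∈ filtrationTensor S (Module.End k L) n :=
        mem_of_mem_filtrationTensor (f := LinearMap.mulLeft k (1 ⊗ₜ S.ad x))
          (fun u hu v => by
            rw [LinearMap.mulLeft_apply, Algebra.TensorProduct.tmul_mul_tmul, one_mul]
            exact tmul_mem_filtrationTensor (filtration_mono (Nat.sub_le n 1) hu) _) h2
      rw [Nat.add_sub_cancel]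
      convert add_mem e3 (add_mem e4 e5) using 1
      rw [map_mul, coaction_ι S hp, hRz, map_add, ← e1, ← e2, S.parity_add]
      simp only [add_mul, mul_add, Algebra.TensorProduct.tmul_mul_tmul, one_mul]
      abel
    · rw [map_add, map_smul, mulRight_tmul, mulRight_rTensor_mulLeft]
      convert sub_mem (ι_mul_mem_filtration x h3) hc using 1
      rw [mul_sub, mul_smul_comm, Nat.cast_succ, add_smul, one_smul]
      abel

theorem filtrationPart_mono {m n : ℕ} (h : m ≤ n) (i : ZMod 2) :
    filtrationPart S m i ≤ filtrationPart S n i :=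
  Submodule.span_mono fun _ ⟨l, hl, hm, e⟩ => ⟨l, hl, hm.trans h, e⟩

theorem exists_isLinearPart {n : ℕ} {i : ZMod 2} {z : Enveloping S}
    (hz : z ∈ filtrationPart S n i) : ∃ t, IsLinearPart n i z t := by
  induction hz using Submodule.span_induction with
  | mem z hz =>
    obtain ⟨l, hl, hn, rfl, rfl⟩ := hz
    obtain ⟨t, h1, h2, h3⟩ := exists_isLinearPart_prod hl
    refine ⟨t, filtrationTensor_mono hn h1, filtrationTensor_mono (Nat.sub_le_sub_right hn 1) h2,
      ?_⟩
    rcases hn.eq_or_lt with rfl | hlt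
    · exact h3
    -- For a word shorter than `n` the factor `n` is not the right one, but the word is itself
    -- negligible, so any multiple of it may be exchanged.
    · have hz := prod_mem_filtration hl hlt
      have h := sub_mem (add_mem (filtration_mono hn h3)
        (Submodule.smul_mem _ (l.length : k) hz)) (Submodule.smul_mem _ (n : k) hz)
      rwa [sub_add_cancel] at h
  | zero => exact ⟨0, by simp, by simp, by simp⟩
  | add z z' _ _ h h' =>
    obtain ⟨t, h1, h2, h3⟩ := h
    obtain ⟨t', h1', h2', h3'⟩ := h'
    refine ⟨t + t', add_mem h1 h1', ?_, ?_⟩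
    · convert add_mem h2 h2' using 1
      simp only [map_add, TensorProduct.add_tmul]; abel
    · convert add_mem h3 h3' using 1
      simp only [map_add, smul_add]; abel
  | smul c z _ h =>
    obtain ⟨t, h1, h2, h3⟩ := h
    refine ⟨c • t, Submodule.smul_mem _ c h1, ?_, ?_⟩
    · convert Submodule.smul_mem _ c h2 using 1
      simp only [map_smul, smul_sub, TensorProduct.smul_tmul']
    · convert Submodule.smul_mem _ c h3 using 1
      rw [map_smul, smul_sub, smul_comm c]

/-! ### Word length against parity, and scalars. -/

theorem exists_mem_filtrationPart {i : ZMod 2} {z : Enveloping S} (hz : z ∈ part S i) :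
    ∃ n, z ∈ filtrationPart S n i := by
  induction hz using Submodule.span_induction with
  | mem z hz =>
    obtain ⟨l, hl, rfl, rfl⟩ := hz
    exact ⟨l.length, Submodule.subset_span ⟨l, hl, le_rfl, rfl, rfl⟩⟩
  | zero => exact ⟨0, zero_mem _⟩
  | add z z' _ _ h h' =>
    obtain ⟨n, h⟩ := h
    obtain ⟨n', h'⟩ := h'
    exact ⟨max n n', add_mem (filtrationPart_mono (le_max_left _ _) i h)
      (filtrationPart_mono (le_max_right _ _) i h')⟩
  | smul c z _ h => exact h.imp fun n h => Submodule.smul_mem _ c h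

theorem filtrationPart_le_part (n : ℕ) (i : ZMod 2) : filtrationPart S n i ≤ part S i :=
  Submodule.span_mono fun _ ⟨l, hl, _, e⟩ => ⟨l, hl, e⟩

theorem decompose_mem_filtrationPart (i : ZMod 2) {n : ℕ} {z : Enveloping S}
    (hz : z ∈ filtration S (n + 1)) :
    (DirectSum.decompose (part S) z i : Enveloping S) ∈ filtrationPart S n i := by
  induction hz using Submodule.span_induction with
  | mem z hz =>
    obtain ⟨l, hl, hn, rfl⟩ := hz
    have hp : (l.map fun p => ι S p.2).prod ∈ part S (l.map Prod.fst).sum :=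
      Submodule.subset_span ⟨l, hl, rfl, rfl⟩
    by_cases hi : (l.map Prod.fst).sum = i
    · subst hi
      rw [DirectSum.decompose_of_mem_same _ hp]
      exact Submodule.subset_span ⟨l, hl, Nat.lt_succ_iff.mp hn, rfl, rfl⟩
    · rw [DirectSum.decompose_of_mem_ne _ hp hi]
      exact zero_mem _
  | zero => simp
  | add z z' _ _ h h' => simpa using add_mem h h'
  | smul c z _ h =>
    rw [DirectSum.decompose_smul]
    exact Submodule.smul_mem _ c h

theorem mem_filtrationPart_of_mem_filtration {i : ZMod 2} {n : ℕ} {z : Enveloping S}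
    (hi : z ∈ part S i) (hz : z ∈ filtration S (n + 1)) : z ∈ filtrationPart S n i := by
  have h := decompose_mem_filtrationPart i hz
  rwa [DirectSum.decompose_of_mem_same _ hi] at h

theorem mem_range_algebraMap_of_mem_filtrationPart_zero {i : ZMod 2} {z : Enveloping S}
    (hz : z ∈ filtrationPart S 0 i) : z ∈ Set.range (algebraMap k (Enveloping S)) := by
  have h : filtrationPart S 0 i ≤ LinearMap.range (Algebra.linearMap k (Enveloping S)) := by
    refine Submodule.span_le.mpr ?_
    rintro _ ⟨l, -, hl, -, rfl⟩
    rw [List.eq_nil_of_length_eq_zero (Nat.le_zero.mp hl)]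
    exact ⟨1, by simp⟩
  exact h hz

/-- The augmentation, which extends the zero map on `L`, is a left inverse. -/
theorem algebraMap_injective : Function.Injective (algebraMap k (Enveloping S)) :=
  Function.LeftInverse.injective (g := lift S (A := k) 0 (by simp)) fun c => by
    rw [AlgHom.commutes]; rfl

/-! ### The supercenter -/

theorem superCommutator_of_mem {A : Type*} [Ring A] [Algebra k A] (𝒜 : ZMod 2 → Submodule k A)
    [GradedAlgebra 𝒜] (z : A) {j : ZMod 2} {u : A} (hu : u ∈ 𝒜 j) :
    superCommutator 𝒜 z u = ∑ i : ZMod 2, ((DirectSum.decompose 𝒜 z i : A) * u -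
      koszulSign k i j • (u * (DirectSum.decompose 𝒜 z i : A))) := by
  refine Finset.sum_congr rfl fun i _ => ?_
  rw [Finset.sum_eq_single j]
  · rw [DirectSum.decompose_of_mem_same _ hu]
  · intro b _ hb
    rw [DirectSum.decompose_of_mem_ne _ hu hb.symm]
    simp
  · simp

/-- For `u` of parity `j`, the contributions of the components of `z` to the supercommutator lie in
the distinct degrees `i + j`, so they vanish separately. -/
theorem decompose_mul_eq_of_mem_superCenter {A : Type*} [Ring A] [Algebra k A]
    (𝒜 : ZMod 2 → Submodule k A) [GradedAlgebra 𝒜] {z : A} (hz : z ∈ superCenter 𝒜) (i : ZMod 2)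
    {j : ZMod 2} {u : A} (hu : u ∈ 𝒜 j) :
    (DirectSum.decompose 𝒜 z i : A) * u =
      koszulSign k i j • (u * (DirectSum.decompose 𝒜 z i : A)) := by
  have h : superCommutator 𝒜 z u = 0 := hz u
  rw [superCommutator_of_mem 𝒜 z hu] at h
  have hm : ∀ i, (DirectSum.decompose 𝒜 z i : A) * u -
      koszulSign k i j • (u * (DirectSum.decompose 𝒜 z i : A)) ∈ 𝒜 (i + j) := fun i => by
    refine sub_mem (SetLike.mul_mem_graded (SetLike.coe_mem _) hu) (Submodule.smul_mem _ _ ?_)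
    rw [add_comm]
    exact SetLike.mul_mem_graded hu (SetLike.coe_mem _)
  have h' := congrArg (GradedRing.proj 𝒜 (i + j)) h
  rw [map_sum, map_zero, Finset.sum_eq_single i, GradedRing.proj_apply,
    DirectSum.decompose_of_mem_same _ (hm i)] at h'
  · exact sub_eq_zero.mp h'
  · intro b _ hb
    exact DirectSum.decompose_of_mem_ne _ (hm b) fun e => hb (add_right_cancel e)
  · simp

theorem algebraMap_mem_superCenter {A : Type*} [Ring A] [Algebra k A]
    (𝒜 : ZMod 2 → Submodule k A) [GradedAlgebra 𝒜] (c : k) :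
    algebraMap k A c ∈ superCenter 𝒜 := by
  intro u
  have hc : algebraMap k A c ∈ 𝒜 0 := SetLike.algebraMap_mem_graded 𝒜 c
  rw [superCommutator, Fintype.sum_eq_single 0]
  · refine Finset.sum_eq_zero fun j _ => ?_
    rw [DirectSum.decompose_of_mem_same _ hc, koszulSign_zero_left, one_smul,
      Algebra.commutes, sub_self]
  · intro i hi
    refine Finset.sum_eq_zero fun j _ => ?_
    rw [DirectSum.decompose_of_mem_ne _ hc hi.symm]
    simp

end Enveloping

end Generic

end LieSuperalgebra

/-! ### Contraction with functionals. -/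

/-- Contraction of the left tensor factor with a linear functional. -/
def contractFst {k U : Type*} [CommRing k] [AddCommGroup U] [Module k U] (V : Type*)
    [AddCommGroup V] [Module k V] (φ : U →ₗ[k] k) : U ⊗[k] V →ₗ[k] V :=
  (TensorProduct.lid k V).toLinearMap ∘ₗ φ.rTensor V

theorem contractFst_tmul {k U V : Type*} [CommRing k] [AddCommGroup U] [Module k U]
    [AddCommGroup V] [Module k V] (φ : U →ₗ[k] k) (u : U) (v : V) :
    contractFst V φ (u ⊗ₜ v) = φ u • v := by
  simp [contractFst]

/-- A tensor whose contractions with all functionals vanishing on `G` vanish lies in `G ⊗ V`. -/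
theorem mem_map₂_of_contractFst_eq_zero {k U V : Type*} [Field k] [AddCommGroup U] [Module k U]
    [AddCommGroup V] [Module k V] {G : Submodule k U} {t : U ⊗[k] V}
    (h : ∀ φ : U →ₗ[k] k, (∀ u ∈ G, φ u = 0) → contractFst V φ t = 0) :
    t ∈ Submodule.map₂ (TensorProduct.mk k U V) G ⊤ := by
  -- Coordinates on `U ⧸ G` pull back to functionals that vanish on `G`, and they detect zero in `(U
  -- ⧸ G) ⊗ V`; exactness of the tensor product then lifts `t` to `G ⊗ V`.
  have h0 : G.mkQ.rTensor V t = 0 := by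
    classical
    let b := Module.Basis.ofVectorSpace k (U ⧸ G)
    apply (TensorProduct.equivFinsuppOfBasisLeft b).injective
    rw [map_zero]
    ext j
    rw [TensorProduct.equivFinsuppOfBasisLeft_apply, Finsupp.zero_apply,
      ← LinearMap.comp_apply (LinearMap.rTensor V _), ← LinearMap.rTensor_comp]
    exact h (b.coord j ∘ₗ G.mkQ) fun u hu => by
      rw [LinearMap.comp_apply, Submodule.mkQ_apply, (Submodule.Quotient.mk_eq_zero G).mpr hu,
        map_zero]
  have hex : Function.Exact G.subtype G.mkQ := by
    rw [LinearMap.exact_iff, Submodule.ker_mkQ, Submodule.range_subtype]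
  obtain ⟨t', rfl⟩ := (Module.Flat.rTensor_exact V hex t).mp h0
  clear h h0
  induction t' with
  | zero => simp
  | tmul g v => exact Submodule.apply_mem_map₂ _ g.2 trivial
  | add a b ha hb => rw [map_add]; exact add_mem ha hb

/-! ### Bases of monomials and the shift by `x^r`. -/

/-- A basis of a `k`-algebra `A` together with elements `mono r` and functionals `coeff s r` that
read off the `s`-th coordinate of `a` from `mono r * a`, and that vanish on any given element for
large `r`; e.g. the basis of monomials, with `mono r = x ^ r`, of an algebra of (Laurent)
polynomials. -/
structure ShiftBasis (k A σ : Type*) [Field k] [CommRing A] [Algebra k A] where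
  basis : Module.Basis σ k A
  mono : ℕ → A
  coeff : σ → ℕ → A →ₗ[k] k
  coeff_mono_mul : ∀ s r a, coeff s r (mono r * a) = basis.coord s a
  eventually_coeff_eq_zero : ∀ s a, ∀ᶠ r in Filter.atTop, coeff s r a = 0

/-- The shift basis of monomials of `k[x]`. -/
def Polynomial.shiftBasis (k : Type*) [Field k] : ShiftBasis k k[X] ℕ where
  basis := Polynomial.basisMonomials k
  mono r := Polynomial.X ^ r
  coeff s r := Polynomial.lcoeff k (s + r)
  coeff_mono_mul s r a := by
    rw [Polynomial.lcoeff_apply, Polynomial.coeff_X_pow_mul]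
    rfl
  eventually_coeff_eq_zero s a := by
    filter_upwards [Filter.eventually_gt_atTop a.natDegree] with r hr
    exact Polynomial.coeff_eq_zero_of_natDegree_lt (by omega)

/-- The shift basis of monomials of `k[x, x⁻¹]`. -/
def LaurentPolynomial.shiftBasis (k : Type*) [Field k] : ShiftBasis k k[T;T⁻¹] ℤ where
  basis := AddMonoidAlgebra.basis ℤ k
  mono r := LaurentPolynomial.T r
  coeff s r := Finsupp.lapply (s + r) ∘ₗ (AddMonoidAlgebra.coeffLinearEquiv k).toLinearMap
  coeff_mono_mul s r a := by
    have h := AddMonoidAlgebra.coeff_single_mul_eq_mul_coeff (r := (1 : k)) (x := a) (m := (r : ℤ))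
      (m₁ := s + r) s (fun m' _ => by constructor <;> intro h <;> omega)
    rw [one_mul] at h
    exact h
  eventually_coeff_eq_zero s a := by
    obtain ⟨R, hR⟩ := a.coeff.support.bddAbove
    -- `R` bounds the exponents of `a`, and `s + r` exceeds `R` for these `r`.
    filter_upwards [Filter.eventually_gt_atTop (R - s).toNat] with r hr
    by_contra hne
    have := hR (Finset.mem_coe.mpr (Finsupp.mem_support_iff.mpr hne))
    omega

namespace LieSuperalgebra

/-! ### Semisimple Lie superalgebras have no center. -/

section Center

variable {k L : Type*} [CommRing k] [AddCommGroup L] [Module k L] {S : LieSuperalgebra k L}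

theorem proj_bracket_eq_zero {y : L} (h : ∀ x, S.bracket x y = 0) (i : ZMod 2) (x : L) :
    S.bracket x (S.proj i y) = 0 := by
  have hj : ∀ j, ∀ x ∈ S.part j, S.bracket x (S.proj 0 y) = 0 ∧ S.bracket x (S.proj 1 y) = 0 :=
    fun j x hx => S.eq_zero_of_add_eq_zero (i := j)
      (by simpa using S.bracket_mem hx (S.proj_mem 0 y)) (S.bracket_mem hx (S.proj_mem 1 y))
      (by rw [← map_add, S.proj_add_proj, h])
  rw [← S.proj_add_proj x, map_add, LinearMap.add_apply]
  rcases zmod_two_cases i with rfl | rfl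
  · rw [(hj 0 _ (S.proj_mem 0 x)).1, (hj 1 _ (S.proj_mem 1 x)).1, add_zero]
  · rw [(hj 0 _ (S.proj_mem 0 x)).2, (hj 1 _ (S.proj_mem 1 x)).2, add_zero]

/-- The center of a semisimple Lie superalgebra is zero. -/
theorem IsSemisimple.eq_zero_of_bracket_eq_zero (hS : S.IsSemisimple) {y : L}
    (h : ∀ x, S.bracket x y = 0) : y = 0 := by
  let I : Submodule k L := LinearMap.ker S.bracket.flip
  have hI : ∀ {y : L}, y ∈ I ↔ ∀ x, S.bracket x y = 0 := fun {y} => by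
    simp only [I, LinearMap.mem_ker, LinearMap.ext_iff, LinearMap.flip_apply, LinearMap.zero_apply]
  have hbot : I = ⊥ := by
    -- The center is a graded ideal, and it is abelian, so its derived series vanishes after one
    -- step.
    refine hS I ⟨le_antisymm (sup_le inf_le_left inf_le_left) fun y hy => ?_, ?_⟩ ⟨1, ?_⟩
    · rw [← S.proj_add_proj y]
      exact add_mem
        (Submodule.mem_sup_left ⟨hI.mpr (proj_bracket_eq_zero (hI.mp hy) 0), S.proj_mem 0 y⟩)
        (Submodule.mem_sup_right ⟨hI.mpr (proj_bracket_eq_zero (hI.mp hy) 1), S.proj_mem 1 y⟩)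
    · intro x y hy
      rw [hI.mp hy x]
      exact zero_mem _
    · rw [derivedSeries, eq_bot_iff, Submodule.map₂_le]
      intro x _ y hy
      exact hI.mp hy x
  exact (Submodule.mem_bot k).mp (hbot ▸ hI.mpr h)

theorem IsSemisimple.eq_zero_of_bracket_bracket_eq_zero (hS : S.IsSemisimple) {i : ZMod 2} {y : L}
    (hy : y ∈ S.part i)
    (h : ∀ j l, ∀ e ∈ S.part j, ∀ f ∈ S.part l, S.bracket (S.bracket e y) f = 0) : y = 0 := by
  have hz : ∀ j, ∀ e ∈ S.part j, S.bracket e y = 0 := fun j e he =>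
    hS.eq_zero_of_bracket_eq_zero fun f => LinearMap.congr_fun (f := S.bracket.flip (S.bracket e y))
      (g := 0) (S.linearMap_ext fun l f hf => by
        rw [LinearMap.flip_apply, S.bracket_skew hf (S.bracket_mem he hy), h j l e he f hf]
        simp) f
  exact hS.eq_zero_of_bracket_eq_zero fun e => LinearMap.congr_fun (f := S.bracket.flip y)
    (g := 0) (S.linearMap_ext fun j e he => hz j e he) e

end Center

namespace Enveloping

/-! ### The supercommutation relation under the coaction. -/

section Commutator

variable {k L : Type*} [CommRing k] [AddCommGroup L] [Module k L] {S : LieSuperalgebra k L}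

theorem contractFst_mul_one_tmul (φ : Enveloping S →ₗ[k] k)
    (T : Enveloping S ⊗[k] Module.End k L) (a : Module.End k L) :
    contractFst _ φ (T * (1 ⊗ₜ a)) = contractFst _ φ T * a := by
  induction T with
  | zero => simp
  | tmul u b => simp [contractFst_tmul]
  | add T T' h h' => simp only [add_mul, map_add, h, h']

theorem contractFst_one_tmul_mul (φ : Enveloping S →ₗ[k] k)
    (T : Enveloping S ⊗[k] Module.End k L) (a : Module.End k L) :
    contractFst _ φ ((1 ⊗ₜ a) * T) = a * contractFst _ φ T := by
  induction T with
  | zero => simp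
  | tmul u b => simp [contractFst_tmul]
  | add T T' h h' => simp only [mul_add, map_add, h, h']

theorem contractFst_twistedAdTensor (φ : Enveloping S →ₗ[k] k) (i : ZMod 2)
    (t : Enveloping S ⊗[k] L) :
    contractFst _ φ (twistedAdTensor S i t) =
      S.parity i * S.twistedAd (contractFst _ φ t) := by
  induction t with
  | zero => simp
  | tmul u b => simp [contractFst_tmul, twistedAdTensor_tmul]
  | add T T' h h' => simp only [mul_add, map_add, h, h']

/-- On each parity component of `y` the Jacobi identity turns the commutator into `ad` of a bracket;
the powers of `P` account for all the signs. -/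
theorem ad_mul_parity_mul_twistedAd {i j : ZMod 2} {u : L} (hu : u ∈ S.part j) (y : L) :
    koszulSign k i j • (S.ad u * (S.parity i * S.twistedAd y)) -
        S.parity i * S.twistedAd y * S.ad u =
      S.parity i * (S.ad (S.bracket u (S.proj 0 y)) +
        koszulSign k 1 j • (S.parity 1 * S.ad (S.bracket u (S.proj 1 y)))) := by
  have h0 := S.ad_mul_ad hu (S.proj_mem 0 y)
  have h1 := S.ad_mul_ad hu (S.proj_mem 1 y)
  rw [← mul_assoc, S.ad_mul_parity i hu, smul_mul_assoc, smul_smul, koszulSign_mul_self, one_smul,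
    mul_assoc, mul_assoc, ← mul_sub, twistedAd_apply, mul_add, add_mul, ← mul_assoc (S.ad u),
    S.ad_mul_parity 1 hu, smul_mul_assoc, mul_assoc, mul_assoc, h0, h1, koszulSign_zero_right,
    one_smul, koszulSign_comm k j 1, mul_add, smul_add, mul_smul_comm, smul_smul,
    koszulSign_mul_self, one_smul]
  congr 1
  abel

/-- If `z` supercommutes with `u ∈ L`, then so do `coaction z` and `coaction u`; this is the
contraction of that identity with a functional. -/
theorem contractFst_commutator {i j : ZMod 2} {z : Enveloping S} {u : L} (hu : u ∈ S.part j)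
    (hzu : z * ι S u = koszulSign k i j • (ι S u * z)) {T : Enveloping S ⊗[k] Module.End k L}
    (hT : coaction S z = z ⊗ₜ S.parity i + T) (φ : Enveloping S →ₗ[k] k) :
    contractFst _ φ (T * (ι S u ⊗ₜ S.parity j)) -
        koszulSign k i j • contractFst _ φ ((ι S u ⊗ₜ S.parity j) * T) =
      koszulSign k i j • (S.ad u * contractFst _ φ T) - contractFst _ φ T * S.ad u := by
  have h := congrArg (coaction S) hzu
  rw [map_mul, map_smul, map_mul, coaction_ι S hu, hT] at h
  simp only [mul_add, add_mul, Algebra.TensorProduct.tmul_mul_tmul, mul_one, one_mul] at h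
  rw [hzu, S.ad_mul_parity i hu, ← S.parity_add, ← S.parity_add, add_comm j i] at h
  -- The terms that come from `z ⊗ P^i` cancel: against `u ⊗ P^j` by `hzu`, and against `1 ⊗ ad u`
  -- because two equal signs multiply to `1`.
  have h' : T * (ι S u ⊗ₜ S.parity j) + T * (1 ⊗ₜ S.ad u) =
      koszulSign k i j • ((ι S u ⊗ₜ S.parity j) * T + (1 ⊗ₜ S.ad u) * T) := by
    simp only [smul_add, TensorProduct.tmul_smul, ← TensorProduct.smul_tmul', smul_smul,
      koszulSign_mul_self, one_smul] at h
    rw [smul_add]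
    rw [← sub_eq_zero] at h ⊢
    rw [← h]
    abel
  have h'' := congrArg (contractFst _ φ) h'
  rw [map_add, map_smul, map_add, contractFst_mul_one_tmul, contractFst_one_tmul_mul,
    smul_add] at h''
  rw [sub_eq_sub_iff_add_eq_add, h'']
  abel

end Commutator

/-! ### The center of `U(L ⊗ A)`. -/

section Tensor

variable {k L A σ : Type*} [Field k] [AddCommGroup L] [Module k L] [CommRing A] [Algebra k A]
  {S : LieSuperalgebra k L}

/-- Application of a functional to the coefficients of an element of `L ⊗ A`. -/
def coeffMap (L : Type*) [AddCommGroup L] [Module k L] (c : A →ₗ[k] k) : L ⊗[k] A →ₗ[k] L :=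
  (TensorProduct.rid k L).toLinearMap ∘ₗ c.lTensor L

theorem coeffMap_tmul (c : A →ₗ[k] k) (e : L) (a : A) : coeffMap L c (e ⊗ₜ a) = c a • e := by
  simp [coeffMap]

theorem coeffMap_mem {c : A →ₗ[k] k} {i : ZMod 2} {x : L ⊗[k] A} (hx : x ∈ (S.tensor A).part i) :
    coeffMap L c x ∈ S.part i :=
  S.tensorPart_induction A (p := fun x => coeffMap L c x ∈ S.part i) (by simp)
    (fun e he a => by rw [coeffMap_tmul]; exact Submodule.smul_mem _ _ he)
    (fun x y hx hy => by rw [map_add]; exact add_mem hx hy) hx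

theorem eq_zero_of_coeffMap_eq_zero (b : Module.Basis σ k A) {x : L ⊗[k] A}
    (h : ∀ s, coeffMap L (b.coord s) x = 0) : x = 0 := by
  classical
  apply (TensorProduct.equivFinsuppOfBasisRight b).injective
  rw [map_zero]
  ext s
  rw [TensorProduct.equivFinsuppOfBasisRight_apply]
  exact h s

theorem coeffMap_bracket_bracket (B : ShiftBasis k A σ) (s : σ) (r : ℕ) (e f : L)
    (y : L ⊗[k] A) :
    coeffMap L (B.coeff s r) ((S.tensor A).bracket ((S.tensor A).bracket (e ⊗ₜ B.mono r) y)
      (f ⊗ₜ 1)) = S.bracket (S.bracket e (coeffMap L (B.basis.coord s) y)) f := by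
  change coeffMap L (B.coeff s r) (S.tensorBracket A (S.tensorBracket A (e ⊗ₜ B.mono r) y)
      (f ⊗ₜ 1)) = _
  induction y with
  | zero => simp
  | tmul g a =>
    simp only [tensorBracket_tmul, coeffMap_tmul, mul_one, B.coeff_mono_mul, map_smul,
      LinearMap.smul_apply]
  | add y y' h h' => simp only [map_add, LinearMap.add_apply, h, h']

theorem eventually_coeffMap_eq_zero (B : ShiftBasis k A σ) (s : σ) (x : L ⊗[k] A) :
    ∀ᶠ r in Filter.atTop, coeffMap L (B.coeff s r) x = 0 := by
  induction x with
  | zero => simp only [map_zero, Filter.eventually_true]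
  | tmul e a =>
    filter_upwards [B.eventually_coeff_eq_zero s a] with r hr
    rw [coeffMap_tmul, hr, zero_smul]
  | add x y hx hy =>
    filter_upwards [hx, hy] with r hx hy
    rw [map_add, hx, hy, add_zero]

/-- `T` involves finitely many endomorphisms, and `u` enters only through scalar values of `φ`. The
threshold for `r` is therefore uniform in `u`, as it must be for `u = e ⊗ x^r`, which depends on
`r`. -/
theorem eventually_coeffMap_contractFst_eq_zero (B : ShiftBasis k A σ) (s : σ)
    (φ : Enveloping (S.tensor A) →ₗ[k] k)
    (T : Enveloping (S.tensor A) ⊗[k] Module.End k (L ⊗[k] A)) (P : Module.End k (L ⊗[k] A))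
    (m : L ⊗[k] A) :
    ∀ᶠ r in Filter.atTop, ∀ u : Enveloping (S.tensor A),
      coeffMap L (B.coeff s r) (contractFst (Module.End k (L ⊗[k] A)) φ (T * (u ⊗ₜ P)) m) = 0 ∧
      coeffMap L (B.coeff s r) (contractFst (Module.End k (L ⊗[k] A)) φ ((u ⊗ₜ P) * T) m) = 0 := by
  induction T with
  | zero => simp
  | tmul w a =>
    filter_upwards [eventually_coeffMap_eq_zero B s ((a * P) m),
      eventually_coeffMap_eq_zero B s ((P * a) m)] with r h h' u
    simp only [Algebra.TensorProduct.tmul_mul_tmul, contractFst_tmul, LinearMap.smul_apply,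
      map_smul, h, h', smul_zero, and_self]
  | add T T' hT hT' =>
    filter_upwards [hT, hT'] with r h h' u
    simp only [add_mul, mul_add, map_add, LinearMap.add_apply, (h u).1, (h u).2, (h' u).1,
      (h' u).2, add_zero, and_self]

theorem contractFst_eq_zero (hS : S.IsSemisimple) (B : ShiftBasis k A σ) {n : ℕ} {i : ZMod 2}
    {z : Enveloping (S.tensor A)} {t : Enveloping (S.tensor A) ⊗[k] (L ⊗[k] A)}
    (hz : ∀ j, ∀ u ∈ (S.tensor A).part j,
      z * ι (S.tensor A) u = koszulSign k i j • (ι (S.tensor A) u * z))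
    (ht : IsLinearPart n i z t) {φ : Enveloping (S.tensor A) →ₗ[k] k}
    (hφ : ∀ u ∈ filtration (S.tensor A) (n - 1), φ u = 0) :
    contractFst _ φ t = 0 := by
  set y := contractFst _ φ t with hy
  set T := coaction (S.tensor A) z - z ⊗ₜ (S.tensor A).parity i with hTdef
  have hT : coaction (S.tensor A) z = z ⊗ₜ (S.tensor A).parity i + T := by rw [hTdef]; abel
  have hφT : contractFst _ φ T = (S.tensor A).parity i * (S.tensor A).twistedAd y := by
    -- `φ` kills the remainder in the coaction of `z`, so only the linear part survives.
    have h : contractFst _ φ (T - twistedAdTensor (S.tensor A) i t) = 0 :=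
      (Submodule.mem_bot k).mp (mem_of_mem_filtrationTensor (p := ⊥) (fun u hu v => by
        rw [contractFst_tmul, hφ u hu, zero_smul]
        exact zero_mem _) ht.coaction_sub)
    rw [map_sub, sub_eq_zero, contractFst_twistedAdTensor] at h
    exact h
  have key : ∀ s, ∀ j l, ∀ e ∈ S.part j, ∀ f ∈ S.part l,
      S.bracket (S.bracket e (coeffMap L (B.basis.coord s) ((S.tensor A).proj 0 y))) f = 0 ∧
      S.bracket (S.bracket e (coeffMap L (B.basis.coord s) ((S.tensor A).proj 1 y))) f = 0 := by
    intro s j l e he f hf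
    -- For this `r` the left side of the contracted commutator identity has zero coefficient in
    -- degree `s + r`.
    obtain ⟨r, hr⟩ := (eventually_coeffMap_contractFst_eq_zero B s φ T ((S.tensor A).parity j)
      (f ⊗ₜ 1)).exists
    have hu : e ⊗ₜ B.mono r ∈ (S.tensor A).part j := S.tmul_mem_tensorPart A he _
    have hm : f ⊗ₜ (1 : A) ∈ (S.tensor A).part l := S.tmul_mem_tensorPart A hf _
    have h := contractFst_commutator hu (hz j _ hu) hT φ
    rw [hφT, ad_mul_parity_mul_twistedAd hu] at h
    have h' := congrArg (fun a => coeffMap L (B.coeff s r) (a (f ⊗ₜ 1))) h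
    have hv0 := (S.tensor A).bracket_mem ((S.tensor A).bracket_mem hu ((S.tensor A).proj_mem 0 y)) hm
    have hv1 := (S.tensor A).bracket_mem ((S.tensor A).bracket_mem hu ((S.tensor A).proj_mem 1 y)) hm
    simp only [LinearMap.sub_apply, LinearMap.smul_apply, map_sub, map_smul, (hr _).1, (hr _).2,
      smul_zero, sub_zero, Module.End.mul_apply, LinearMap.add_apply, map_add, ad_apply,
      (S.tensor A).parity_apply hv0, (S.tensor A).parity_apply hv1, coeffMap_bracket_bracket B] at h'
    -- `y` need not be homogeneous: its two components contribute values of opposite parity, so each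
    -- of them vanishes, the signs being invertible.
    have hb0 : S.bracket (S.bracket e (coeffMap L (B.basis.coord s) ((S.tensor A).proj 0 y))) f ∈
        S.part (j + 0 + l) :=
      S.bracket_mem (S.bracket_mem he (coeffMap_mem ((S.tensor A).proj_mem 0 y))) hf
    have hb1 : S.bracket (S.bracket e (coeffMap L (B.basis.coord s) ((S.tensor A).proj 1 y))) f ∈
        S.part (j + 0 + l + 1) := by
      rw [add_zero, add_right_comm]
      exact S.bracket_mem (S.bracket_mem he (coeffMap_mem ((S.tensor A).proj_mem 1 y))) hf
    obtain ⟨h0, h1⟩ := S.eq_zero_of_add_eq_zero (Submodule.smul_mem _ _ hb0)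
      (Submodule.smul_mem _ _ (Submodule.smul_mem _ _ (Submodule.smul_mem _ _ hb1))) h'.symm
    exact ⟨eq_zero_of_koszulSign_smul h0, eq_zero_of_koszulSign_smul
      (eq_zero_of_koszulSign_smul (eq_zero_of_koszulSign_smul h1))⟩
  have hc : ∀ i, (S.tensor A).proj i y = 0 := fun i =>
    eq_zero_of_coeffMap_eq_zero B.basis fun s =>
      hS.eq_zero_of_bracket_bracket_eq_zero (coeffMap_mem ((S.tensor A).proj_mem i y))
        fun j l e he f hf => by
          rcases zmod_two_cases i with rfl | rfl
          · exact (key s j l e he f hf).1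
          · exact (key s j l e he f hf).2
  rw [← (S.tensor A).proj_add_proj y, hc 0, hc 1, add_zero]

theorem mem_range_algebraMap_of_supercommute [CharZero k] (hS : S.IsSemisimple)
    (B : ShiftBasis k A σ) {i : ZMod 2} {z : Enveloping (S.tensor A)}
    (hz : ∀ j, ∀ u ∈ (S.tensor A).part j,
      z * ι (S.tensor A) u = koszulSign k i j • (ι (S.tensor A) u * z)) {n : ℕ}
    (hn : z ∈ filtrationPart (S.tensor A) n i) :
    z ∈ Set.range (algebraMap k (Enveloping (S.tensor A))) := by
  induction n with
  | zero => exact mem_range_algebraMap_of_mem_filtrationPart_zero hn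
  | succ n ih =>
    refine ih (mem_filtrationPart_of_mem_filtration (filtrationPart_le_part _ _ hn) ?_)
    obtain ⟨t, ht⟩ := exists_isLinearPart hn
    have htn : t ∈ filtrationTensor (S.tensor A) (L ⊗[k] A) n :=
      -- This is one step better than `ht.mem`, which only places `t` in level `n + 1`.
      mem_map₂_of_contractFst_eq_zero fun φ hφ => contractFst_eq_zero hS B hz ht hφ
    have hμ : mulRight (S.tensor A) t ∈ filtration (S.tensor A) (n + 1) :=
      mem_of_mem_filtrationTensor (fun u hu v => by
        rw [mulRight_tmul]
        exact mul_ι_mem_filtration v hu) htn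
    have h := sub_mem hμ ht.mulRight_sub
    rw [sub_sub_cancel] at h
    -- Characteristic `0` is needed to divide `(n + 1) z` by `n + 1`.
    exact (Submodule.smul_mem_iff _ (Nat.cast_ne_zero.mpr n.succ_ne_zero)).mp h

theorem envelopingCenter_tensor_eq [CharZero k] (hS : S.IsSemisimple) (B : ShiftBasis k A σ) :
    ((S.tensor A).envelopingCenter : Set (Enveloping (S.tensor A))) =
      Set.range (algebraMap k (Enveloping (S.tensor A))) := by
  classical
  apply Set.Subset.antisymm
  · intro z hz
    have h : ∀ i, (DirectSum.decompose (part (S.tensor A)) z i : Enveloping (S.tensor A)) ∈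
        LinearMap.range (Algebra.linearMap k (Enveloping (S.tensor A))) := fun i => by
      obtain ⟨n, hn⟩ := exists_mem_filtrationPart
        (SetLike.coe_mem (DirectSum.decompose (part (S.tensor A)) z i))
      exact mem_range_algebraMap_of_supercommute hS B (fun j u hu =>
        decompose_mul_eq_of_mem_superCenter _ hz i (ι_mem_part _ hu)) hn
    rw [← DirectSum.sum_support_decompose (part (S.tensor A)) z]
    exact Submodule.sum_mem (LinearMap.range (Algebra.linearMap k (Enveloping (S.tensor A))))
      fun i _ => h i
  · rintro _ ⟨c, rfl⟩
    exact algebraMap_mem_superCenter _ c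

end Tensor

end Enveloping

end LieSuperalgebra

end

theorem proposition3p2p3 {k L : Type*} [Field k] [IsAlgClosed k] [CharZero k]
    [AddCommGroup L] [Module k L] (S : LieSuperalgebra k L) (hS : S.IsSemisimple) :
    (Function.Injective (algebraMap k S.current.Enveloping) ∧
      (S.current.envelopingCenter : Set S.current.Enveloping) =
        Set.range (algebraMap k S.current.Enveloping)) ∧
    (Function.Injective (algebraMap k S.loop.Enveloping) ∧
      (S.loop.envelopingCenter : Set S.loop.Enveloping) =
        Set.range (algebraMap k S.loop.Enveloping)) :=
  ⟨⟨LieSuperalgebra.Enveloping.algebraMap_injective,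
    LieSuperalgebra.Enveloping.envelopingCenter_tensor_eq hS (Polynomial.shiftBasis k)⟩,
    LieSuperalgebra.Enveloping.algebraMap_injective,
    LieSuperalgebra.Enveloping.envelopingCenter_tensor_eq hS (LaurentPolynomial.shiftBasis k)⟩
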